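/- Let $p:\mathbb R\to\mathbb R$ be such that $p,p'\in AC_{loc}(\mathbb R)$ and $p(x)>0$ for all $x$. Let $\mu_p(I)=\int_I p^{-1/2}$, $\zeta(x)=\int_0^x p^{-1/2}(u)\,du$, and let the potential $q$ be given by $q(\zeta(x))=\frac14 p''(x)-\frac1{16}\frac{p'(x)^2}{p(x)}$. On $L^2(\mathbb R)$ (complex valued), let $A_p$ and $B_q$ be the maximal operators of the expressions $-(pf')'$ and $-f''+qf$, where the maximal operator of $\tau f=-(pf')'+qf$ has domain $\{f\in L^2(\mathbb R): f,\,pf'\in AC_{loc},\ \tau f\in L^2(\mathbb R)\}$. For a Borel set $\Lambda\subseteq\mathbb R$ (in particular, for one of finite measure) and an operator $A$ with spectral measure $E$, put $PW_\Lambda(A)=\{f\in L^2(\mathbb R): E(\Lambda)f=f\}$. Let the Liouville transform be $U_Lf=(p^{1/4}f)\circ\zeta^{-1}$. For $X\subseteq\mathbb R$ put $$D_p^+(X)=\limsup_{r\to\infty}\sup_{\mu_p(I)=r}\frac{\#(X\cap I)}r,\qquad D_p^-(X)=\liminf_{r\to\infty}\inf_{\mu_p(I)=r}\frac{\#(X\cap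 I)}r\qquad(I\text{ a compact interval}),$$ with values in $[0,\infty]$, and let $D^\pm$ be the same quantities for $p\equiv1$, i.e. for Lebesgue measure. A reproducing kernel of a space $V\subseteq L^2(\mathbb R)$ is a family $k(x,\cdot)\in V$, $x\in\mathbb R$, such that for every $f\in V$ the function $x\mapsto\langle f,k(x,\cdot)\rangle$ is a continuous representative of $f$. Assume first that $\int_0^\infty p^{-1/2}=\int_{-\infty}^0p^{-1/2}=\infty$, i.e. that $\zeta$ maps $\mathbb R$ onto $\mathbb R$. Then: 1. $U_L\big(PW_\Lambda(A_p)\big)=PW_\Lambda(B_q)$. 2. $D_p^{\pm}(X)=D^{\pm}(\zeta(X))$ for every $X\subseteq\mathbb R$. 3. If $k$ is the reproducing kernel of $PW_\Lambda(A_p)$ and $h$ is the reproducing kernel of $PW_\Lambda(B_q)$, then $h(\zeta(x),\cdot)=p^{1/4}(x)\,U_Lk(x,\cdot)$ for all $x\in\mathbb R$. 4. If $0<c\le p(x)\le C$ for all $x\in\mathbb R$ (so that $\zeta$ is automatically onto), and $k,h$ are the reproducing kernels as in 3, then for every $X\subseteq\mathbb R$ the family $(k(x,\cdot))_{x\in X}$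 is a frame for $PW_\Lambda(A_p)$ if and only if $(h(\zeta(x),\cdot))_{x\in X}$ is a frame for $PW_\Lambda(B_q)$; and $(k(x,\cdot))_{x\in X}$ is a Riesz sequence for $PW_\Lambda(A_p)$ if and only if $(h(\zeta(x),\cdot))_{x\in X}$ is a Riesz sequence for $PW_\Lambda(B_q)$. -/

import Mathlib

open MeasureTheory Set Filter Topology
open scoped ENNReal

noncomputable section

namespace VariableBandwidth

/-! ### Locally absolutely continuous functions -/

/-- The class `AC_loc(ℝ)`: absolute continuity on every compact interval. -/
def LocAC {F : Type*} [NormedAddCommGroup F] (u : ℝ → F) : Prop :=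
  ∀ a b : ℝ, AbsolutelyContinuousOnInterval u a b

theorem LocAC.continuous {F : Type*} [NormedAddCommGroup F] {u : ℝ → F} (hu : LocAC u) :
    Continuous u := by
  rw [continuous_iff_continuousAt]
  intro x
  refine (hu (x - 1) (x + 1)).continuousOn.continuousAt ?_
  rw [uIcc_of_le (by linarith)]
  exact Icc_mem_nhds (by linarith) (by linarith)

theorem LocAC.ae_differentiableAt {u : ℝ → ℂ} (hu : LocAC u) :
    ∀ᵐ x, DifferentiableAt ℝ u x := by
  apply LocallyBoundedVariationOn.ae_differentiableAt
  intro a b _ _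
  rcases le_total a b with h | h
  · have := (hu a b).boundedVariationOn
    rw [uIcc_of_le h] at this
    simpa using this
  · have hs : (univ ∩ Icc a b : Set ℝ).Subsingleton := by
      rintro x ⟨_, hx1, hx2⟩ y ⟨_, hy1, hy2⟩
      linarith
    rw [BoundedVariationOn, eVariationOn.subsingleton u hs]
    exact ENNReal.zero_ne_top

/-! ### The Hilbert space and the maximal Sturm-Liouville operators -/

/-- The complex Hilbert space `L²(ℝ)`. -/
abbrev L2 : Type := Lp ℂ 2 (volume : Measure ℝ)

/-- The graph of the maximal operator of `τ f = -(p f')' + q f`: the pairs `(f, g)` in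
`L² × L²` such that `f` has a representative `u ∈ AC_loc`, the function `p u'` has a
representative `v ∈ AC_loc`, and `g = -v' + q u` almost everywhere. -/
def slGraph (p q : ℝ → ℝ) : Submodule ℂ (L2 × L2) where
  carrier := {fg | ∃ u v : ℝ → ℂ, LocAC u ∧ LocAC v ∧ (fg.1 : ℝ → ℂ) =ᵐ[volume] u ∧
    (∀ᵐ x, v x = (p x : ℂ) * deriv u x) ∧
    (∀ᵐ x, (fg.2 : ℝ → ℂ) x = -deriv v x + (q x : ℂ) * u x)}
  zero_mem' := by
    refine ⟨0, 0, ?_, ?_, Lp.coeFn_zero _ _ _, ?_, ?_⟩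
    · intro a b
      exact (LipschitzWith.const (0 : ℂ)).lipschitzOnWith.absolutelyContinuousOnInterval
    · intro a b
      exact (LipschitzWith.const (0 : ℂ)).lipschitzOnWith.absolutelyContinuousOnInterval
    · simp
    · simp
  add_mem' := by
    rintro ⟨f₁, g₁⟩ ⟨f₂, g₂⟩ ⟨u₁, v₁, hu₁, hv₁, hf₁, hp₁, hg₁⟩ ⟨u₂, v₂, hu₂, hv₂, hf₂, hp₂, hg₂⟩
    refine ⟨u₁ + u₂, v₁ + v₂, fun a b => (hu₁ a b).add (hu₂ a b),
      fun a b => (hv₁ a b).add (hv₂ a b), (Lp.coeFn_add f₁ f₂).trans (hf₁.add hf₂), ?_, ?_⟩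
    · filter_upwards [hp₁, hp₂, hu₁.ae_differentiableAt, hu₂.ae_differentiableAt]
        with x h₁ h₂ d₁ d₂
      rw [Pi.add_apply, h₁, h₂, deriv_add d₁ d₂]
      ring
    · filter_upwards [hg₁, hg₂, hv₁.ae_differentiableAt, hv₂.ae_differentiableAt,
        Lp.coeFn_add g₁ g₂] with x h₁ h₂ d₁ d₂ h
      change (g₁ + g₂ : L2) x = _
      rw [h, Pi.add_apply, h₁, h₂, deriv_add d₁ d₂, Pi.add_apply]
      ring
  smul_mem' := by
    rintro c ⟨f, g⟩ ⟨u, v, hu, hv, hf, hp, hg⟩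
    refine ⟨c • u, c • v, fun a b => (hu a b).const_smul c, fun a b => (hv a b).const_smul c,
      (Lp.coeFn_smul c f).trans (hf.const_smul c), ?_, ?_⟩
    · filter_upwards [hp, hu.ae_differentiableAt] with x h d
      rw [Pi.smul_apply, h, deriv_const_smul c d, smul_eq_mul, smul_eq_mul]
      ring
    · filter_upwards [hg, hv.ae_differentiableAt, Lp.coeFn_smul c g] with x h d hc
      change (c • g : L2) x = _
      rw [hc, Pi.smul_apply, h, deriv_const_smul c d, Pi.smul_apply, smul_eq_mul, smul_eq_mul,
        smul_eq_mul]
      ring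

theorem slGraph_functional (p q : ℝ → ℝ) (fg : L2 × L2) (h : fg ∈ slGraph p q)
    (h0 : fg.1 = 0) : fg.2 = 0 := by
  obtain ⟨u, v, hu, hv, hf, hp, hg⟩ := h
  have hu0 : u = 0 := by
    refine Measure.eq_of_ae_eq (μ := volume) ?_ hu.continuous continuous_const
    rw [h0] at hf
    exact hf.symm.trans (Lp.coeFn_zero _ _ _)
  subst hu0
  have hv0 : v = 0 := by
    refine Measure.eq_of_ae_eq (μ := volume) ?_ hv.continuous continuous_const
    filter_upwards [hp] with x hx
    simp [hx]
  subst hv0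
  refine Lp.ext ?_
  filter_upwards [hg, Lp.coeFn_zero ℂ 2 (volume : Measure ℝ)] with x hx h
  rw [hx, h]
  simp

/-- The maximal operator `A` of `τ f = -(p f')' + q f` in `L²(ℝ)`, with domain
`{f ∈ L² : f, p f' ∈ AC_loc, τ f ∈ L²}`. -/
def slOperator (p q : ℝ → ℝ) : L2 →ₗ.[ℂ] L2 := (slGraph p q).toLinearPMap

theorem slOperator_graph (p q : ℝ → ℝ) : (slOperator p q).graph = slGraph p q :=
  Submodule.toLinearPMap_graph_eq _ (slGraph_functional p q)

/-- `A_p f = -(p f')'`. -/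
def opA (p : ℝ → ℝ) : L2 →ₗ.[ℂ] L2 := slOperator p (fun _ => 0)

/-- `B_q f = -f'' + q f`. -/
def opB (q : ℝ → ℝ) : L2 →ₗ.[ℂ] L2 := slOperator (fun _ => 1) q

/-! ### Spectral measures and Paley-Wiener spaces -/

/-- A projection-valued Borel measure on `ℝ`: orthogonal projections, total mass `1`, countably
additive in the strong operator topology. (Values on non-Borel sets are irrelevant.) -/
structure ProjMeasure (H : Type*) [NormedAddCommGroup H] [InnerProductSpace ℂ H]
    [CompleteSpace H] where
  proj : Set ℝ → H →L[ℂ] H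
  isStarProjection : ∀ s, MeasurableSet s → IsStarProjection (proj s)
  proj_univ : proj univ = 1
  hasSum_iUnion : ∀ s : ℕ → Set ℝ, (∀ i, MeasurableSet (s i)) →
    Pairwise (Function.onFun Disjoint s) →
    ∀ f : H, HasSum (fun i => proj (s i) f) (proj (⋃ i, s i) f)

namespace ProjMeasure

variable {H : Type*} [NormedAddCommGroup H] [InnerProductSpace ℂ H] [CompleteSpace H]

theorem norm_sq_proj (E : ProjMeasure H) {s : Set ℝ} (hs : MeasurableSet s) (f : H) :
    ‖E.proj s f‖ ^ 2 = (inner ℂ f (E.proj s f)).re := by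
  have hE := E.isStarProjection s hs
  have h1 : E.proj s (E.proj s f) = E.proj s f :=
    DFunLike.congr_fun hE.isIdempotentElem f
  have h2 : inner ℂ (E.proj s f) (E.proj s f) = inner ℂ f (E.proj s f) := by
    have := ContinuousLinearMap.adjoint_inner_right (E.proj s) f (E.proj s f)
    rw [← ContinuousLinearMap.star_eq_adjoint, hE.isSelfAdjoint.star_eq, h1] at this
    exact this.symm
  rw [← h2, inner_self_eq_norm_sq_to_K]
  norm_cast

theorem proj_empty (E : ProjMeasure H) (f : H) : E.proj ∅ f = 0 := by
  have h := E.hasSum_iUnion (fun _ => ∅) (fun _ => MeasurableSet.empty)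
    (fun i j _ => by simp [Function.onFun]) f
  exact tendsto_nhds_unique tendsto_const_nhds h.summable.tendsto_atTop_zero

/-- The scalar spectral measure `s ↦ ‖E(s) f‖² = ⟨E(s) f, f⟩`. -/
def scalarMeasure (E : ProjMeasure H) (f : H) : Measure ℝ :=
  Measure.ofMeasurable (fun s _ => ENNReal.ofReal (‖E.proj s f‖ ^ 2))
    (by simp [E.proj_empty f])
    (by
      intro s hs hd
      have h := (E.hasSum_iUnion s hs hd f).mapL (innerSL ℂ f)
      have h' := Complex.hasSum_re h
      simp only [innerSL_apply_apply] at h'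
      simp only [← E.norm_sq_proj (hs _), ← E.norm_sq_proj (MeasurableSet.iUnion hs)] at h'
      rw [← h'.tsum_eq]
      exact ENNReal.ofReal_tsum_of_nonneg (fun i => by positivity) h'.summable)

/-- `E` is the spectral measure of the (unbounded) operator `A`, i.e. `A = ∫ t dE(t)` with domain
`{f : ∫ t² d‖E(t) f‖² < ∞}`. (By polarization, the quadratic form on the dense domain
determines `A`.) -/
def IsSpectralMeasure (E : ProjMeasure H) (A : H →ₗ.[ℂ] H) : Prop :=
  (∀ f : H, f ∈ A.domain ↔ ∫⁻ t, ENNReal.ofReal (t ^ 2) ∂(E.scalarMeasure f) < ∞) ∧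
  ∀ f : A.domain, inner ℂ (f : H) (A f) = ((∫ t, t ∂(E.scalarMeasure (f : H)) : ℝ) : ℂ)

end ProjMeasure

/-- The Paley-Wiener space `PW_Λ(A) = {f : c_Λ(A) f = f}`, where the spectral projection
`c_Λ(A)` is the value at `Λ` of the spectral measure of `A` (which, for self-adjoint `A`, exists
and is unique on Borel sets). -/
def PW {H : Type*} [NormedAddCommGroup H] [InnerProductSpace ℂ H] [CompleteSpace H]
    (Λ : Set ℝ) (A : H →ₗ.[ℂ] H) : Set H :=
  {f | ∃ E : ProjMeasure H, E.IsSpectralMeasure A ∧ E.proj Λ f = f}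

/-- `k : x ↦ k(x, ·)` is the reproducing kernel of the space `V` of `L²` functions, whose elements
are identified with their continuous representatives: every `k(x, ·)` is in `V`, and
every `f ∈ V` has the continuous representative `x ↦ ⟨f, k(x, ·)⟩`. -/
def IsReproducingKernel (V : Set L2) (k : ℝ → L2) : Prop :=
  (∀ x, k x ∈ V) ∧ ∀ f ∈ V, Continuous (fun x => inner ℂ (k x) f) ∧
    (f : ℝ → ℂ) =ᵐ[volume] fun x => inner ℂ (k x) f

/-! ### Frames and Riesz sequences -/

/-- The family `v` is a frame for `V`. -/
def IsFrame {H : Type*} [NormedAddCommGroup H] [InnerProductSpace ℂ H] (V : Set H)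
    {ι : Type*} (v : ι → H) : Prop :=
  (∀ i, v i ∈ V) ∧ ∃ a b : ℝ, 0 < a ∧ 0 < b ∧ ∀ f ∈ V,
    ENNReal.ofReal (a * ‖f‖ ^ 2) ≤ ∑' i, ENNReal.ofReal (‖inner ℂ (v i) f‖ ^ 2) ∧
    ∑' i, ENNReal.ofReal (‖inner ℂ (v i) f‖ ^ 2) ≤ ENNReal.ofReal (b * ‖f‖ ^ 2)

/-- The family `v` is a Riesz sequence for `V`; part of the definition is that `∑ c_i v_i`
converges for all `c ∈ ℓ²`. -/
def IsRieszSequence {H : Type*} [NormedAddCommGroup H] [InnerProductSpace ℂ H] (V : Set H)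
    {ι : Type*} (v : ι → H) : Prop :=
  (∀ i, v i ∈ V) ∧ ∃ a b : ℝ, 0 < a ∧ 0 < b ∧ ∀ c : ι → ℂ, Summable (fun i => ‖c i‖ ^ 2) →
    Summable (fun i => c i • v i) ∧
    a * ∑' i, ‖c i‖ ^ 2 ≤ ‖∑' i, c i • v i‖ ^ 2 ∧
    ‖∑' i, c i • v i‖ ^ 2 ≤ b * ∑' i, ‖c i‖ ^ 2

/-! ### Beurling densities -/

/-- Upper Beurling density of `X` with respect to `μ`:
`limsup_{r → ∞} sup_{μ(I) = r} #(X ∩ I) / r`, with `I` a compact interval. -/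
def upperDensity (μ : Measure ℝ) (X : Set ℝ) : ℝ≥0∞ :=
  limsup (fun r : ℝ => ⨆ (a : ℝ) (b : ℝ) (_ : μ (Icc a b) = ENNReal.ofReal r),
    ((X ∩ Icc a b).encard : ℝ≥0∞) / ENNReal.ofReal r) atTop

/-- Lower Beurling density of `X` with respect to `μ`:
`liminf_{r → ∞} inf_{μ(I) = r} #(X ∩ I) / r`, with `I` a compact interval. -/
def lowerDensity (μ : Measure ℝ) (X : Set ℝ) : ℝ≥0∞ :=
  liminf (fun r : ℝ => ⨅ (a : ℝ) (b : ℝ) (_ : μ (Icc a b) = ENNReal.ofReal r),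
    ((X ∩ Icc a b).encard : ℝ≥0∞) / ENNReal.ofReal r) atTop

/-- `μ_p(I) = ∫_I p^{-1/2}`. -/
def muP (p : ℝ → ℝ) : Measure ℝ :=
  volume.withDensity fun u => ENNReal.ofReal (p u ^ (-(1 / 2) : ℝ))

/-! ### The Liouville transform -/

/-- `ζ(x) = ∫₀ˣ p^{-1/2}`. -/
def zeta (p : ℝ → ℝ) (x : ℝ) : ℝ := ∫ u in (0 : ℝ)..x, p u ^ (-(1 / 2) : ℝ)

/-- The inverse of `ζ` (used where `ζ` is a bijection of `ℝ`). -/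
def zetaInv (p : ℝ → ℝ) : ℝ → ℝ := Function.invFun (zeta p)

/-- `(p^{1/4} f) ∘ ζ⁻¹` as a function. -/
def liouvilleFun (p : ℝ → ℝ) (f : ℝ → ℂ) (y : ℝ) : ℂ :=
  ((p (zetaInv p y) ^ (1 / 4 : ℝ) : ℝ) : ℂ) * f (zetaInv p y)

open Classical in
/-- The Liouville transform `U_L f = (p^{1/4} f) ∘ ζ⁻¹` on `L²(ℝ)`. The `else` branch does not
occur if `p` is continuous and positive and `ζ` is onto, see `memLp_liouvilleFun`. -/
def liouville (p : ℝ → ℝ) (f : L2) : L2 :=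
  if h : MemLp (liouvilleFun p f) 2 volume then h.toLp (liouvilleFun p f) else 0

/-- The potential `q` with `q(ζ(x)) = p''(x) / 4 - p'(x)² / (16 p(x))`. -/
def potential (p : ℝ → ℝ) (y : ℝ) : ℝ :=
  deriv (deriv p) (zetaInv p y) / 4 - deriv p (zetaInv p y) ^ 2 / (16 * p (zetaInv p y))

section WellDefined

variable {p : ℝ → ℝ}

theorem hasDerivAt_zeta (hp : Continuous p) (hpos : ∀ x, 0 < p x) (x : ℝ) :
    HasDerivAt (zeta p) (p x ^ (-(1 / 2) : ℝ)) x := by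
  have hc : Continuous fun u => p u ^ (-(1 / 2) : ℝ) :=
    hp.rpow_const fun x => Or.inl (hpos x).ne'
  exact intervalIntegral.integral_hasDerivAt_right (hc.intervalIntegrable _ _)
    hc.aestronglyMeasurable.stronglyMeasurableAtFilter hc.continuousAt

theorem strictMono_zeta (hp : Continuous p) (hpos : ∀ x, 0 < p x) : StrictMono (zeta p) :=
  strictMono_of_hasDerivAt_pos (hasDerivAt_zeta hp hpos) fun x => Real.rpow_pos_of_pos (hpos x) _

theorem memLp_liouvilleFun (hp : Continuous p) (hpos : ∀ x, 0 < p x)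
    (hζ : Function.Surjective (zeta p)) (f : L2) : MemLp (liouvilleFun p f) 2 volume := by
  have hmono := strictMono_zeta hp hpos
  have hl : ∀ x, zetaInv p (zeta p x) = x := Function.leftInverse_invFun hmono.injective
  have hr : ∀ y, zeta p (zetaInv p y) = y := Function.rightInverse_invFun hζ
  have hinv : Measurable (zetaInv p) := by
    refine Monotone.measurable fun a b hab => ?_
    rw [← hmono.le_iff_le, hr, hr]
    exact hab
  have hsm : Measurable (liouvilleFun p f) := by
    have h1 : Measurable fun x => ((p x ^ (1 / 4 : ℝ) : ℝ) : ℂ) :=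
      Complex.measurable_ofReal.comp (hp.measurable.pow_const _)
    exact (h1.comp hinv).mul ((Lp.stronglyMeasurable f).measurable.comp hinv)
  refine ⟨hsm.aestronglyMeasurable, ?_⟩
  have hf := (Lp.memLp f).2
  rw [eLpNorm_lt_top_iff_lintegral_rpow_enorm_lt_top two_ne_zero ENNReal.ofNat_ne_top] at hf ⊢
  refine lt_of_eq_of_lt ?_ hf
  have hcv := lintegral_image_eq_lintegral_abs_deriv_mul (s := univ) MeasurableSet.univ
    (fun x _ => (hasDerivAt_zeta hp hpos x).hasDerivWithinAt) hmono.injective.injOn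
    (fun y => ‖liouvilleFun p f y‖ₑ ^ (2 : ℝ≥0∞).toReal)
  rw [image_univ, hζ.range_eq, Measure.restrict_univ] at hcv
  rw [hcv]
  refine lintegral_congr fun x => ?_
  have hx := hpos x
  have e : |p x ^ (-(1 / 2) : ℝ)| * (p x ^ (1 / 4 : ℝ)) ^ 2 = 1 := by
    rw [abs_of_pos (Real.rpow_pos_of_pos hx _), ← Real.rpow_natCast, ← Real.rpow_mul hx.le,
      ← Real.rpow_add hx]
    norm_num
  have e' : ‖((p x ^ (1 / 4 : ℝ) : ℝ) : ℂ)‖ₑ = ENNReal.ofReal (p x ^ (1 / 4 : ℝ)) := by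
    rw [← ofReal_norm, Complex.norm_real, Real.norm_of_nonneg (by positivity)]
  simp only [liouvilleFun, hl, enorm_mul, e', ENNReal.toReal_ofNat, ENNReal.rpow_ofNat]
  rw [mul_pow, ← mul_assoc, ← ENNReal.ofReal_pow (by positivity),
    ← ENNReal.ofReal_mul (abs_nonneg _), e, ENNReal.ofReal_one, one_mul]

end WellDefined

end VariableBandwidth

end

open VariableBandwidth

/-!
The map `ζ` pushes `μ_p` forward to Lebesgue measure. Hence `U_L` is unitary, and densities with
respect to `μ_p` turn into densities with respect to Lebesgue measure. Together with `u`, the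
transform carries the quasi-derivative `p u'` to the derivative of `w = (p^{1/4} u) ∘ ζ⁻¹`, since
`w' ∘ ζ = p^{-1/4} (p u' + p' u / 4)`. This relation preserves local absolute continuity in both
directions, so `U_L` intertwines the two maximal operators. Consequently it carries spectral
measures, and with them Paley-Wiener spaces, to each other. Reproducing kernels acquire the factor
`p^{1/4}` because they represent point evaluation, which `U_L` preserves only up to this factor; if
`p` is bounded above and away from zero, the factor does not affect frames and Riesz sequences.
-/

noncomputable section

namespace VariableBandwidth

/-! ### Calculus of locally absolutely continuous functions -/

namespace LocAC

section NormedAddCommGroup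

variable {F : Type*} [NormedAddCommGroup F] {u v : ℝ → F}

theorem add (hu : LocAC u) (hv : LocAC v) : LocAC fun x => u x + v x :=
  fun a b => (hu a b).add (hv a b)

theorem sub (hu : LocAC u) (hv : LocAC v) : LocAC fun x => u x - v x :=
  fun a b => (hu a b).sub (hv a b)

theorem add_iff_left (hv : LocAC v) : (LocAC fun x => u x + v x) ↔ LocAC u :=
  ⟨fun h => by simpa only [add_sub_cancel_right] using h.sub hv, fun hu => hu.add hv⟩

theorem smul {M : Type*} [NormedRing M] [Module M F] [NormSMulClass M F] {r : ℝ → M}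
    (hr : LocAC r) (hu : LocAC u) : LocAC fun x => r x • u x :=
  fun a b => (hr a b).smul (hu a b)

theorem comp_monotone {ψ : ℝ → ℝ} (hu : LocAC u) (hψ : LocAC ψ) (hm : Monotone ψ) :
    LocAC fun x => u (ψ x) := by
  intro a b
  have hu' := hu (ψ a) (ψ b)
  have hψ' := hψ a b
  rw [absolutelyContinuousOnInterval_iff] at hu' hψ' ⊢
  intro ε hε
  obtain ⟨δ, hδ, h⟩ := hu' ε hε
  obtain ⟨η, hη, h'⟩ := hψ' δ hδ
  refine ⟨η, hη, fun E hE hlen => ?_⟩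
  refine h (E.1, fun i => (ψ (E.2 i).1, ψ (E.2 i).2)) ⟨fun i hi => ?_, fun i hi j hj hij => ?_⟩
    (h' E hE hlen)
  · exact ⟨hm.mapsTo_uIcc (hE.1 i hi).1, hm.mapsTo_uIcc (hE.1 i hi).2⟩
  · have hd := hE.2 hi hj hij
    simp only [Function.onFun, uIoc, Ioc_disjoint_Ioc, ← hm.map_min, ← hm.map_max] at hd ⊢
    exact hm hd

end NormedAddCommGroup

section NormedSpace

variable {F : Type*} [NormedAddCommGroup F] [NormedSpace ℝ F] {u : ℝ → F} {r : ℝ → ℝ}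

theorem of_contDiff (hu : ContDiff ℝ 1 u) : LocAC u :=
  fun _ _ => hu.contDiffOn.absolutelyContinuousOnInterval

theorem smul_iff (hr : ContDiff ℝ 1 r) (hr0 : ∀ x, r x ≠ 0) :
    (LocAC fun x => r x • u x) ↔ LocAC u := by
  refine ⟨fun h => ?_, (of_contDiff hr).smul⟩
  simpa only [Pi.inv_apply, inv_smul_smul₀ (hr0 _)] using (of_contDiff (hr.inv hr0)).smul h

theorem ae_differentiableAt_of_finiteDimensional [FiniteDimensional ℝ F] (hu : LocAC u) :
    ∀ᵐ x, DifferentiableAt ℝ u x :=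
  LocallyBoundedVariationOn.ae_differentiableAt fun a b _ _ =>
    (hu a b).boundedVariationOn.mono (inter_subset_right.trans Icc_subset_uIcc)

end NormedSpace

theorem contDiff_one {u : ℝ → ℝ} (hu : LocAC u) (hu' : Continuous (deriv u)) :
    ContDiff ℝ 1 u := by
  have hint : u = fun y => u 0 + ∫ t in (0 : ℝ)..y, deriv u t := by
    funext y
    rw [(hu 0 y).integral_deriv_eq_sub]
    ring
  have hderiv (x : ℝ) : HasDerivAt u (deriv u x) x := by
    have h := (hu'.integral_hasStrictDerivAt 0 x).hasDerivAt.const_add (u 0)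
    rwa [← hint] at h
  exact contDiff_one_iff_deriv.2 ⟨fun x => (hderiv x).differentiableAt, hu'⟩

end LocAC

/-! ### Unitary equivalence -/

section Unitary

variable {H K : Type*} [NormedAddCommGroup H] [InnerProductSpace ℂ H]
  [NormedAddCommGroup K] [InnerProductSpace ℂ K]

/-- The unitary `U` carries the unbounded operator `A` to `B`, i.e. `B = U A U⁻¹` with
`dom B = U (dom A)`; expressed through graphs. -/
def Intertwines (U : H ≃ₗᵢ[ℂ] K) (A : H →ₗ.[ℂ] H) (B : K →ₗ.[ℂ] K) : Prop :=
  ∀ f g : H, (U f, U g) ∈ B.graph ↔ (f, g) ∈ A.graph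

namespace Intertwines

variable {U : H ≃ₗᵢ[ℂ] K} {A : H →ₗ.[ℂ] H} {B : K →ₗ.[ℂ] K}

theorem symm (h : Intertwines U A B) : Intertwines U.symm B A := fun f g => by
  rw [← h, U.apply_symm_apply, U.apply_symm_apply]

theorem map_mem_domain_iff (h : Intertwines U A B) {f : H} : U f ∈ B.domain ↔ f ∈ A.domain := by
  simp only [LinearPMap.mem_domain_iff, U.surjective.exists, h f]

theorem apply_map (h : Intertwines U A B) (f : A.domain) :
    B ⟨U f, h.map_mem_domain_iff.2 f.2⟩ = U (A f) :=
  ((LinearPMap.image_iff _).2 ((h _ _).2 (A.mem_graph f))).symm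

end Intertwines

variable [CompleteSpace H]

theorem smul_mem_PW {Λ : Set ℝ} {A : H →ₗ.[ℂ] H} (c : ℂ) {f : H} (hf : f ∈ PW Λ A) :
    c • f ∈ PW Λ A := by
  obtain ⟨E, hE, h⟩ := hf
  exact ⟨E, hE, by rw [map_smul, h]⟩

variable [CompleteSpace K]

namespace ProjMeasure

/-- The transport `s ↦ U E(s) U⁻¹` of a projection-valued measure along a unitary `U`. -/
def map (E : ProjMeasure H) (U : H ≃ₗᵢ[ℂ] K) : ProjMeasure K where
  proj s := U.conjStarAlgEquiv (E.proj s)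
  isStarProjection s hs := (E.isStarProjection s hs).map U.conjStarAlgEquiv
  proj_univ := by rw [E.proj_univ, map_one]
  hasSum_iUnion s hs hd f :=
    (E.hasSum_iUnion s hs hd (U.symm f)).mapL (U : H →L[ℂ] K)

theorem map_proj_apply (E : ProjMeasure H) (U : H ≃ₗᵢ[ℂ] K) (s : Set ℝ) (f : H) :
    (E.map U).proj s (U f) = U (E.proj s f) := by
  simp only [map, LinearIsometryEquiv.conjStarAlgEquiv_apply_apply,
    LinearIsometryEquiv.symm_apply_apply]

theorem scalarMeasure_map (E : ProjMeasure H) (U : H ≃ₗᵢ[ℂ] K) (f : H) :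
    (E.map U).scalarMeasure (U f) = E.scalarMeasure f := by
  ext s hs
  simp only [scalarMeasure, Measure.ofMeasurable_apply s hs, map_proj_apply, U.norm_map]

end ProjMeasure

namespace Intertwines

variable {U : H ≃ₗᵢ[ℂ] K} {A : H →ₗ.[ℂ] H} {B : K →ₗ.[ℂ] K}

theorem isSpectralMeasure_map (h : Intertwines U A B) {E : ProjMeasure H}
    (hE : E.IsSpectralMeasure A) : (E.map U).IsSpectralMeasure B := by
  refine ⟨fun f => ?_, fun ⟨f, hf⟩ => ?_⟩ <;> obtain ⟨f, rfl⟩ := U.surjective f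
  · rw [h.map_mem_domain_iff, hE.1, E.scalarMeasure_map]
  · have hfA := h.map_mem_domain_iff.1 hf
    rw [h.apply_map ⟨f, hfA⟩, E.scalarMeasure_map, U.inner_map_map, hE.2 ⟨f, hfA⟩]

theorem map_mem_PW (h : Intertwines U A B) {Λ : Set ℝ} {f : H} (hf : f ∈ PW Λ A) :
    U f ∈ PW Λ B := by
  obtain ⟨E, hE, hEf⟩ := hf
  exact ⟨E.map U, h.isSpectralMeasure_map hE, by rw [E.map_proj_apply, hEf]⟩

theorem image_PW (h : Intertwines U A B) (Λ : Set ℝ) : U '' PW Λ A = PW Λ B :=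
  Subset.antisymm (image_subset_iff.2 fun _ => h.map_mem_PW) fun g hg =>
    ⟨U.symm g, h.symm.map_mem_PW hg, U.apply_symm_apply g⟩

end Intertwines

end Unitary

/-! ### Frames and Riesz sequences -/

section FrameRiesz

variable {H K : Type*} [NormedAddCommGroup H] [InnerProductSpace ℂ H]
  [NormedAddCommGroup K] [InnerProductSpace ℂ K] {V : Set H} {ι : Type*} {v : ι → H}

theorem isFrame_image_iff (U : H ≃ₗᵢ[ℂ] K) :
    IsFrame (U '' V) (fun i => U (v i)) ↔ IsFrame V v := by
  simp only [IsFrame, forall_mem_image, U.injective.mem_set_image, U.inner_map_map, U.norm_map]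

theorem isRieszSequence_image_iff (U : H ≃ₗᵢ[ℂ] K) :
    IsRieszSequence (U '' V) (fun i => U (v i)) ↔ IsRieszSequence V v := by
  have htsum (c : ι → ℂ) : ∑' i, U (c i • v i) = U (∑' i, c i • v i) :=
    (U.toContinuousLinearEquiv.map_tsum).symm
  have hsum (c : ι → ℂ) : (Summable fun i => U (c i • v i)) ↔ Summable fun i => c i • v i :=
    U.toContinuousLinearEquiv.summable
  simp only [IsRieszSequence, U.injective.mem_set_image, ← U.map_smul, htsum, hsum, U.norm_map]

variable {r : ι → ℂ} {m M : ℝ}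

theorem IsFrame.smul (hv : IsFrame V v) (hV : ∀ c : ℂ, ∀ f ∈ V, c • f ∈ V) (hm : 0 < m)
    (hM : 0 < M) (hr : ∀ i, ‖r i‖ ∈ Icc m M) : IsFrame V fun i => r i • v i := by
  obtain ⟨hvV, a, b, ha, hb, h⟩ := hv
  refine ⟨fun i => hV _ _ (hvV i), m ^ 2 * a, M ^ 2 * b, by positivity, by positivity,
    fun f hf => ?_⟩
  have hinner (i : ι) : ENNReal.ofReal (‖inner ℂ (r i • v i) f‖ ^ 2) =
      ENNReal.ofReal (‖r i‖ ^ 2) * ENNReal.ofReal (‖inner ℂ (v i) f‖ ^ 2) := by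
    rw [inner_smul_left, norm_mul, mul_pow, RCLike.norm_conj, ENNReal.ofReal_mul (sq_nonneg _)]
  simp only [hinner, mul_assoc, ENNReal.ofReal_mul (sq_nonneg m), ENNReal.ofReal_mul (sq_nonneg M)]
  constructor
  · refine (mul_le_mul_right (h f hf).1 _).trans ?_
    rw [← ENNReal.tsum_mul_left]
    gcongr with i
    exact (hr i).1
  · refine le_trans ?_ (mul_le_mul_right (h f hf).2 _)
    rw [← ENNReal.tsum_mul_left]
    gcongr with i
    exact (hr i).2

theorem IsRieszSequence.smul (hv : IsRieszSequence V v) (hV : ∀ c : ℂ, ∀ f ∈ V, c • f ∈ V)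
    (hm : 0 < m) (hM : 0 < M) (hr : ∀ i, ‖r i‖ ∈ Icc m M) :
    IsRieszSequence V fun i => r i • v i := by
  obtain ⟨hvV, a, b, ha, hb, h⟩ := hv
  refine ⟨fun i => hV _ _ (hvV i), a * m ^ 2, b * M ^ 2, by positivity, by positivity,
    fun c hc => ?_⟩
  have hlow (i : ι) : m ^ 2 * ‖c i‖ ^ 2 ≤ ‖c i * r i‖ ^ 2 := by
    rw [norm_mul, mul_pow, mul_comm]
    gcongr
    exact (hr i).1
  have hupp (i : ι) : ‖c i * r i‖ ^ 2 ≤ M ^ 2 * ‖c i‖ ^ 2 := by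
    rw [norm_mul, mul_pow, mul_comm]
    gcongr
    exact (hr i).2
  have hcr : Summable fun i => ‖c i * r i‖ ^ 2 :=
    (hc.mul_left (M ^ 2)).of_nonneg_of_le (fun i => sq_nonneg _) hupp
  obtain ⟨hsum, hge, hle⟩ := h _ hcr
  simp only [smul_smul, mul_assoc, ← tsum_mul_left (a := m ^ 2), ← tsum_mul_left (a := M ^ 2)]
  refine ⟨hsum, le_trans ?_ hge, hle.trans ?_⟩
  · exact mul_le_mul_of_nonneg_left ((hc.mul_left (m ^ 2)).tsum_le_tsum hlow hcr) ha.le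
  · exact mul_le_mul_of_nonneg_left (hcr.tsum_le_tsum hupp (hc.mul_left (M ^ 2))) hb.le

theorem norm_inv_mem_Icc {𝕜 : Type*} [NormedDivisionRing 𝕜] {z : 𝕜} (hm : 0 < m)
    (hz : ‖z‖ ∈ Icc m M) : ‖z⁻¹‖ ∈ Icc M⁻¹ m⁻¹ := by
  rw [norm_inv]
  exact ⟨inv_anti₀ (hm.trans_le hz.1) hz.2, inv_anti₀ hm hz.1⟩

theorem isFrame_smul_iff (hV : ∀ c : ℂ, ∀ f ∈ V, c • f ∈ V) (hm : 0 < m) (hM : 0 < M)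
    (hr : ∀ i, ‖r i‖ ∈ Icc m M) : IsFrame V (fun i => r i • v i) ↔ IsFrame V v := by
  have hr0 (i : ι) : r i ≠ 0 := norm_pos_iff.1 (hm.trans_le (hr i).1)
  refine ⟨fun h => ?_, fun h => h.smul hV hm hM hr⟩
  simpa only [inv_smul_smul₀ (hr0 _)] using
    h.smul hV (inv_pos.2 hM) (inv_pos.2 hm) fun i => norm_inv_mem_Icc hm (hr i)

theorem isRieszSequence_smul_iff (hV : ∀ c : ℂ, ∀ f ∈ V, c • f ∈ V) (hm : 0 < m) (hM : 0 < M)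
    (hr : ∀ i, ‖r i‖ ∈ Icc m M) :
    IsRieszSequence V (fun i => r i • v i) ↔ IsRieszSequence V v := by
  have hr0 (i : ι) : r i ≠ 0 := norm_pos_iff.1 (hm.trans_le (hr i).1)
  refine ⟨fun h => ?_, fun h => h.smul hV hm hM hr⟩
  simpa only [inv_smul_smul₀ (hr0 _)] using
    h.smul hV (inv_pos.2 hM) (inv_pos.2 hm) fun i => norm_inv_mem_Icc hm (hr i)

end FrameRiesz

/-! ### Beurling densities -/

section Density

variable {μ ν : Measure ℝ} {φ : ℝ ≃o ℝ}

theorem measure_Icc_map (hφ : MeasurePreserving φ μ ν) (a b : ℝ) :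
    ν (Icc (φ a) (φ b)) = μ (Icc a b) := by
  rw [← hφ.measure_preimage measurableSet_Icc.nullMeasurableSet, φ.preimage_Icc,
    φ.symm_apply_apply, φ.symm_apply_apply]

theorem encard_image_inter_Icc (X : Set ℝ) (a b : ℝ) :
    (φ '' X ∩ Icc (φ a) (φ b)).encard = (X ∩ Icc a b).encard := by
  rw [← φ.image_Icc, ← image_inter φ.injective, φ.injective.encard_image]

theorem upperDensity_image (hφ : MeasurePreserving φ μ ν) (X : Set ℝ) :
    upperDensity ν (φ '' X) = upperDensity μ X := by
  unfold upperDensity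
  congr! 2 with r
  refine (φ.surjective.iSup_congr _ fun a =>
    (φ.surjective.iSup_congr _ fun b => ?_).symm).symm
  rw [measure_Icc_map hφ, encard_image_inter_Icc]

theorem lowerDensity_image (hφ : MeasurePreserving φ μ ν) (X : Set ℝ) :
    lowerDensity ν (φ '' X) = lowerDensity μ X := by
  unfold lowerDensity
  congr! 2 with r
  refine (φ.surjective.iInf_congr _ fun a =>
    (φ.surjective.iInf_congr _ fun b => ?_).symm).symm
  rw [measure_Icc_map hφ, encard_image_inter_Icc]

end Density

/-! ### The change of variables `ζ` -/

section Zeta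

theorem surjective_of_forall_le_deriv {f f' : ℝ → ℝ} {m : ℝ} (hm : 0 < m)
    (hf : ∀ x, HasDerivAt f (f' x) x) (hf' : ∀ x, m ≤ f' x) : Function.Surjective f := by
  have hmono : Monotone fun x => f x - m * x := by
    refine monotone_of_hasDerivAt_nonneg (f' := fun x => f' x - m * 1)
      (fun x => (hf x).sub ((hasDerivAt_id x).const_mul m)) fun x => ?_
    simpa only [Pi.zero_apply, mul_one, sub_nonneg] using hf' x
  have hle {x y : ℝ} (hxy : x ≤ y) : f x - m * x ≤ f y - m * y := hmono hxy
  refine (continuous_iff_continuousAt.2 fun x => (hf x).continuousAt).surjective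
    (tendsto_atTop_mono' _ ?_ (tendsto_atTop_add_const_left _ (f 0)
      (tendsto_id.const_mul_atTop hm)))
    (tendsto_atBot_mono' _ ?_ (tendsto_atBot_add_const_left _ (f 0)
      (tendsto_id.const_mul_atBot hm)))
  · filter_upwards [eventually_ge_atTop 0] with x hx
    rw [id]
    linarith [hle hx]
  · filter_upwards [eventually_le_atBot 0] with x hx
    rw [id]
    linarith [hle hx]

variable {p : ℝ → ℝ}

theorem surjective_zeta_of_forall_le (hp : Continuous p) (hpos : ∀ x, 0 < p x) {C : ℝ}
    (hC : ∀ x, p x ≤ C) : Function.Surjective (zeta p) :=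
  surjective_of_forall_le_deriv (Real.rpow_pos_of_pos ((hpos 0).trans_le (hC 0)) (-(1 / 2)))
    (hasDerivAt_zeta hp hpos) fun x =>
      Real.rpow_le_rpow_of_nonpos (hpos x) (hC x) (by norm_num)

theorem zetaInv_zeta (hp : Continuous p) (hpos : ∀ x, 0 < p x) (x : ℝ) :
    zetaInv p (zeta p x) = x :=
  Function.leftInverse_invFun (strictMono_zeta hp hpos).injective x

theorem zeta_zetaInv (hζ : Function.Surjective (zeta p)) (y : ℝ) : zeta p (zetaInv p y) = y :=
  Function.rightInverse_invFun hζ y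

/-- `ζ` as an increasing bijection of `ℝ`, with inverse `zetaInv p`. -/
def zetaOrderIso (hp : Continuous p) (hpos : ∀ x, 0 < p x)
    (hζ : Function.Surjective (zeta p)) : ℝ ≃o ℝ where
  toFun := zeta p
  invFun := zetaInv p
  left_inv := zetaInv_zeta hp hpos
  right_inv := zeta_zetaInv hζ
  map_rel_iff' := (strictMono_zeta hp hpos).le_iff_le

theorem continuous_zetaInv (hp : Continuous p) (hpos : ∀ x, 0 < p x)
    (hζ : Function.Surjective (zeta p)) : Continuous (zetaInv p) :=
  (zetaOrderIso hp hpos hζ).symm.continuous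

theorem measurableEmbedding_zeta (hp : Continuous p) (hpos : ∀ x, 0 < p x)
    (hζ : Function.Surjective (zeta p)) : MeasurableEmbedding (zeta p) :=
  (zetaOrderIso hp hpos hζ).toHomeomorph.measurableEmbedding

theorem measurePreserving_zeta (hp : Continuous p) (hpos : ∀ x, 0 < p x)
    (hζ : Function.Surjective (zeta p)) : MeasurePreserving (zeta p) (muP p) volume := by
  refine ⟨(measurableEmbedding_zeta hp hpos hζ).measurable, ?_⟩
  have h := map_withDensity_abs_det_fderiv_eq_addHaar volume MeasurableSet.univ.nullMeasurableSet
    (fun x _ => (hasDerivAt_zeta hp hpos x).hasFDerivAt.hasFDerivWithinAt)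
    (strictMono_zeta hp hpos).injective.injOn
  simpa only [Measure.restrict_univ, image_univ, hζ.range_eq, muP,
    ContinuousLinearMap.det_toSpanSingleton, abs_of_pos (Real.rpow_pos_of_pos (hpos _) _)] using h

theorem ae_muP_iff (hp : Continuous p) (hpos : ∀ x, 0 < p x) {P : ℝ → Prop} :
    (∀ᵐ x ∂muP p, P x) ↔ ∀ᵐ x, P x := by
  have hpow (x : ℝ) : ENNReal.ofReal (p x ^ (-(1 / 2) : ℝ)) ≠ 0 :=
    (ENNReal.ofReal_pos.2 (Real.rpow_pos_of_pos (hpos x) _)).ne'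
  rw [muP, ae_withDensity_iff (hp.measurable.pow_const _).ennreal_ofReal]
  simp only [ne_eq, hpow, not_false_eq_true, forall_true_left]

theorem ae_comp_zeta_iff (hp : Continuous p) (hpos : ∀ x, 0 < p x)
    (hζ : Function.Surjective (zeta p)) {P : ℝ → Prop} :
    (∀ᵐ x, P (zeta p x)) ↔ ∀ᵐ y, P y := by
  rw [← ae_muP_iff hp hpos, ← (measurableEmbedding_zeta hp hpos hζ).ae_map_iff,
    (measurePreserving_zeta hp hpos hζ).map_eq]

theorem upperDensity_image_zeta (hp : Continuous p) (hpos : ∀ x, 0 < p x)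
    (hζ : Function.Surjective (zeta p)) (X : Set ℝ) :
    upperDensity volume (zeta p '' X) = upperDensity (muP p) X :=
  upperDensity_image (φ := zetaOrderIso hp hpos hζ) (measurePreserving_zeta hp hpos hζ) X

theorem lowerDensity_image_zeta (hp : Continuous p) (hpos : ∀ x, 0 < p x)
    (hζ : Function.Surjective (zeta p)) (X : Set ℝ) :
    lowerDensity volume (zeta p '' X) = lowerDensity (muP p) X :=
  lowerDensity_image (φ := zetaOrderIso hp hpos hζ) (measurePreserving_zeta hp hpos hζ) X

end Zeta

/-! ### The weight `p^{1/4}` and calculus along `ζ` -/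

section Weight

/-- The weight `p^{1/4}` of the Liouville transform. -/
def liouvilleWeight (p : ℝ → ℝ) (x : ℝ) : ℝ := p x ^ (1 / 4 : ℝ)

variable {p : ℝ → ℝ}

theorem liouvilleWeight_pos (hpos : ∀ x, 0 < p x) (x : ℝ) : 0 < liouvilleWeight p x :=
  Real.rpow_pos_of_pos (hpos x) _

theorem liouvilleWeight_pow_four (hpos : ∀ x, 0 < p x) (x : ℝ) :
    liouvilleWeight p x ^ 4 = p x := by
  rw [liouvilleWeight, ← Real.rpow_natCast, ← Real.rpow_mul (hpos x).le]
  norm_num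

theorem rpow_neg_half_eq (hpos : ∀ x, 0 < p x) (x : ℝ) :
    p x ^ (-(1 / 2) : ℝ) = (liouvilleWeight p x ^ 2)⁻¹ := by
  rw [liouvilleWeight, Real.rpow_neg (hpos x).le, ← Real.rpow_natCast, ← Real.rpow_mul (hpos x).le]
  norm_num

theorem norm_liouvilleWeight_mem_Icc {c C : ℝ} (hc : 0 < c) {x : ℝ} (hx : p x ∈ Icc c C) :
    ‖(liouvilleWeight p x : ℂ)‖ ∈ Icc (c ^ (1 / 4 : ℝ)) (C ^ (1 / 4 : ℝ)) := by
  have hpx : 0 < p x := hc.trans_le hx.1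
  rw [liouvilleWeight, Complex.norm_of_nonneg (Real.rpow_nonneg hpx.le _)]
  exact ⟨Real.rpow_le_rpow hc.le hx.1 (by norm_num), Real.rpow_le_rpow hpx.le hx.2 (by norm_num)⟩

theorem contDiff_liouvilleWeight (hp : ContDiff ℝ 1 p) (hpos : ∀ x, 0 < p x) :
    ContDiff ℝ 1 (liouvilleWeight p) :=
  hp.rpow_const_of_ne fun x => (hpos x).ne'

theorem continuous_liouvilleWeight (hp : Continuous p) : Continuous (liouvilleWeight p) :=
  hp.rpow_const fun _ => Or.inr (by norm_num)

theorem hasDerivAt_liouvilleWeight (hp : ContDiff ℝ 1 p) (hpos : ∀ x, 0 < p x) (x : ℝ) :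
    HasDerivAt (liouvilleWeight p) (deriv p x / (4 * liouvilleWeight p x ^ 3)) x := by
  have hpow : p x ^ ((1 / 4 : ℝ) - 1) = (liouvilleWeight p x ^ 3)⁻¹ := by
    rw [liouvilleWeight, ← Real.rpow_natCast, ← Real.rpow_mul (hpos x).le,
      ← Real.rpow_neg (hpos x).le]
    norm_num
  convert! (hp.differentiable one_ne_zero x).hasDerivAt.rpow_const (p := 1 / 4)
    (Or.inl (hpos x).ne') using 1
  rw [hpow]
  ring

theorem hasDerivAt_zetaInv (hp : Continuous p) (hpos : ∀ x, 0 < p x)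
    (hζ : Function.Surjective (zeta p)) (y : ℝ) :
    HasDerivAt (zetaInv p) (liouvilleWeight p (zetaInv p y) ^ 2) y := by
  have h := (hasDerivAt_zeta hp hpos (zetaInv p y)).of_local_left_inverse
    (continuous_zetaInv hp hpos hζ).continuousAt (Real.rpow_pos_of_pos (hpos _) _).ne'
    (.of_forall (zeta_zetaInv hζ))
  rwa [rpow_neg_half_eq hpos, inv_inv] at h

theorem locAC_zeta (hp : Continuous p) (hpos : ∀ x, 0 < p x) : LocAC (zeta p) := by
  refine .of_contDiff (contDiff_one_iff_deriv.2
    ⟨fun x => (hasDerivAt_zeta hp hpos x).differentiableAt, ?_⟩)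
  rw [funext fun x => (hasDerivAt_zeta hp hpos x).deriv]
  exact hp.rpow_const fun x => Or.inl (hpos x).ne'

theorem locAC_zetaInv (hp : Continuous p) (hpos : ∀ x, 0 < p x)
    (hζ : Function.Surjective (zeta p)) : LocAC (zetaInv p) := by
  refine .of_contDiff (contDiff_one_iff_deriv.2
    ⟨fun y => (hasDerivAt_zetaInv hp hpos hζ y).differentiableAt, ?_⟩)
  rw [funext fun y => (hasDerivAt_zetaInv hp hpos hζ y).deriv]
  exact ((continuous_liouvilleWeight hp).comp (continuous_zetaInv hp hpos hζ)).pow 2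

variable {F : Type*} [NormedAddCommGroup F] {w : ℝ → F}

theorem hasDerivAt_of_comp_zeta [NormedSpace ℝ F] (hp : Continuous p) (hpos : ∀ x, 0 < p x)
    (hζ : Function.Surjective (zeta p)) {W : ℝ → F} (hW : ∀ t, w (zeta p t) = W t) {D : F} {x : ℝ}
    (h : HasDerivAt W D x) : HasDerivAt w (liouvilleWeight p x ^ 2 • D) (zeta p x) := by
  obtain rfl : (fun t => w (zeta p t)) = W := funext hW
  have hinv := hasDerivAt_zetaInv hp hpos hζ (zeta p x)
  rw [zetaInv_zeta hp hpos] at hinv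
  simpa only [Function.comp_def, zeta_zetaInv hζ] using
    h.scomp_of_eq (zeta p x) hinv (zetaInv_zeta hp hpos x).symm

theorem locAC_comp_zeta_iff (hp : Continuous p) (hpos : ∀ x, 0 < p x)
    (hζ : Function.Surjective (zeta p)) : (LocAC fun x => w (zeta p x)) ↔ LocAC w := by
  refine ⟨fun h => ?_, fun h => h.comp_monotone (locAC_zeta hp hpos)
    (strictMono_zeta hp hpos).monotone⟩
  simpa only [zeta_zetaInv hζ] using
    h.comp_monotone (locAC_zetaInv hp hpos hζ) (zetaOrderIso hp hpos hζ).symm.monotone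

end Weight

/-! ### The Liouville transform as a unitary operator -/

section Liouville

variable {p : ℝ → ℝ}

theorem liouvilleFun_zeta (hp : Continuous p) (hpos : ∀ x, 0 < p x) (f : ℝ → ℂ) (x : ℝ) :
    liouvilleFun p f (zeta p x) = liouvilleWeight p x • f x := by
  rw [liouvilleFun, zetaInv_zeta hp hpos, Complex.real_smul, liouvilleWeight]

theorem liouvilleFun_inv_smul_comp_zeta (hpos : ∀ x, 0 < p x) (hζ : Function.Surjective (zeta p))
    (w : ℝ → ℂ) : liouvilleFun p (fun x => (liouvilleWeight p x)⁻¹ • w (zeta p x)) = w := by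
  funext y
  rw [liouvilleFun, ← liouvilleWeight, ← Complex.real_smul, zeta_zetaInv hζ,
    smul_inv_smul₀ (liouvilleWeight_pos hpos _).ne']

theorem surjective_liouvilleFun (hpos : ∀ x, 0 < p x) (hζ : Function.Surjective (zeta p)) :
    Function.Surjective (liouvilleFun p) :=
  fun w => ⟨_, liouvilleFun_inv_smul_comp_zeta hpos hζ w⟩

theorem eLpNorm_liouvilleFun (hp : Continuous p) (hpos : ∀ x, 0 < p x)
    (hζ : Function.Surjective (zeta p)) (f : ℝ → ℂ) :
    eLpNorm (liouvilleFun p f) 2 volume = eLpNorm f 2 volume := by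
  have hdensity (x : ℝ) :
      ENNReal.ofReal (p x ^ (-(1 / 2) : ℝ)) * ‖liouvilleWeight p x‖ₑ ^ 2 = 1 := by
    have hr := liouvilleWeight_pos hpos x
    rw [Real.enorm_of_nonneg hr.le, ← ENNReal.ofReal_pow hr.le,
      ← ENNReal.ofReal_mul (Real.rpow_nonneg (hpos x).le _), rpow_neg_half_eq hpos,
      inv_mul_cancel₀ (pow_pos hr 2).ne', ENNReal.ofReal_one]
  have hlintegral : ∫⁻ y, ‖liouvilleFun p f y‖ₑ ^ 2 = ∫⁻ x, ‖f x‖ₑ ^ 2 := by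
    rw [← (measurePreserving_zeta hp hpos hζ).lintegral_comp_emb
      (measurableEmbedding_zeta hp hpos hζ), muP,
      lintegral_withDensity_eq_lintegral_mul_non_measurable _
        (hp.measurable.pow_const _).ennreal_ofReal (.of_forall fun _ => ENNReal.ofReal_lt_top)]
    simp only [Pi.mul_apply, liouvilleFun_zeta hp hpos, enorm_smul, mul_pow, ← mul_assoc, hdensity,
      one_mul]
  simp only [eLpNorm_eq_lintegral_rpow_enorm_toReal two_ne_zero ENNReal.ofNat_ne_top,
    ENNReal.toReal_ofNat, ENNReal.rpow_ofNat, hlintegral]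

theorem coeFn_liouville (hp : Continuous p) (hpos : ∀ x, 0 < p x)
    (hζ : Function.Surjective (zeta p)) (f : L2) :
    (liouville p f : ℝ → ℂ) =ᵐ[volume] liouvilleFun p f := by
  have h := memLp_liouvilleFun hp hpos hζ f
  rw [liouville, dif_pos h]
  exact h.coeFn_toLp

theorem ae_liouville_zeta (hp : Continuous p) (hpos : ∀ x, 0 < p x)
    (hζ : Function.Surjective (zeta p)) (f : L2) :
    ∀ᵐ x, (liouville p f : ℝ → ℂ) (zeta p x) = liouvilleWeight p x • f x := by
  filter_upwards [(ae_comp_zeta_iff hp hpos hζ).2 (coeFn_liouville hp hpos hζ f)] with x hx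
  rw [hx, liouvilleFun_zeta hp hpos]

theorem liouville_eq_iff (hp : Continuous p) (hpos : ∀ x, 0 < p x)
    (hζ : Function.Surjective (zeta p)) {f g : L2} :
    liouville p f = g ↔ ∀ᵐ x, (g : ℝ → ℂ) (zeta p x) = liouvilleWeight p x • f x := by
  refine ⟨fun h => h ▸ ae_liouville_zeta hp hpos hζ f, fun h => Lp.ext ?_⟩
  refine (ae_comp_zeta_iff hp hpos hζ).1 ?_
  filter_upwards [h, ae_liouville_zeta hp hpos hζ f] with x hg hf
  rw [hg, hf]

theorem norm_liouville (hp : Continuous p) (hpos : ∀ x, 0 < p x)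
    (hζ : Function.Surjective (zeta p)) (f : L2) : ‖liouville p f‖ = ‖f‖ := by
  rw [Lp.norm_def, Lp.norm_def, eLpNorm_congr_ae (coeFn_liouville hp hpos hζ f),
    eLpNorm_liouvilleFun hp hpos hζ]

theorem surjective_liouville (hp : Continuous p) (hpos : ∀ x, 0 < p x)
    (hζ : Function.Surjective (zeta p)) : Function.Surjective (liouville p) := by
  intro g
  set f : ℝ → ℂ := fun x => (liouvilleWeight p x)⁻¹ • g (zeta p x) with hf
  have hmeas : Measurable f := (continuous_liouvilleWeight hp).measurable.inv.smul
    ((Lp.stronglyMeasurable g).measurable.comp (measurableEmbedding_zeta hp hpos hζ).measurable)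
  have hfL2 : MemLp f 2 volume := by
    refine ⟨hmeas.aestronglyMeasurable, ?_⟩
    rw [← eLpNorm_liouvilleFun hp hpos hζ, hf, liouvilleFun_inv_smul_comp_zeta hpos hζ]
    exact (Lp.memLp g).2
  refine ⟨hfL2.toLp f, (liouville_eq_iff hp hpos hζ).2 ?_⟩
  filter_upwards [hfL2.coeFn_toLp] with x hx
  rw [hx, smul_inv_smul₀ (liouvilleWeight_pos hpos x).ne']

/-- The Liouville transform as a unitary operator on `L²(ℝ)`. -/
def liouvilleEquiv (hp : Continuous p) (hpos : ∀ x, 0 < p x)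
    (hζ : Function.Surjective (zeta p)) : L2 ≃ₗᵢ[ℂ] L2 :=
  LinearIsometryEquiv.ofSurjective
    { toFun := liouville p
      map_add' := fun f g => by
        refine (liouville_eq_iff hp hpos hζ).2 ?_
        filter_upwards [ae_liouville_zeta hp hpos hζ f, ae_liouville_zeta hp hpos hζ g,
          Lp.coeFn_add f g, (ae_comp_zeta_iff hp hpos hζ).2
            (Lp.coeFn_add (liouville p f) (liouville p g))] with x hf hg hadd hUadd
        rw [hUadd, hadd, Pi.add_apply, Pi.add_apply, hf, hg, smul_add]
      map_smul' := fun c f => by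
        refine (liouville_eq_iff hp hpos hζ).2 ?_
        filter_upwards [ae_liouville_zeta hp hpos hζ f, Lp.coeFn_smul c f,
          (ae_comp_zeta_iff hp hpos hζ).2 (Lp.coeFn_smul c (liouville p f))] with x hf hsmul hUsmul
        rw [RingHom.id_apply, hUsmul, hsmul, Pi.smul_apply, Pi.smul_apply, hf, smul_comm]
      norm_map' := norm_liouville hp hpos hζ }
    (surjective_liouville hp hpos hζ)

@[simp]
theorem coe_liouvilleEquiv (hp : Continuous p) (hpos : ∀ x, 0 < p x)
    (hζ : Function.Surjective (zeta p)) : ⇑(liouvilleEquiv hp hpos hζ) = liouville p :=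
  rfl

end Liouville

/-! ### The Liouville transform of a Sturm-Liouville operator -/

section Graph

/-- For `w = (p^{1/4} u) ∘ ζ⁻¹` and `v = p u'` this is the derivative `w'`; writing it in terms of
`v` shows that it is locally absolutely continuous whenever `u` and `v` are. -/
def liouvilleQuasiDeriv (p : ℝ → ℝ) (u v : ℝ → ℂ) (y : ℝ) : ℂ :=
  (liouvilleWeight p (zetaInv p y))⁻¹ •
    (v (zetaInv p y) + (deriv p (zetaInv p y) / 4) • u (zetaInv p y))

/-- The potential of the Schrödinger operator into which the Liouville transform carries
`-(p f')' + Q f`. -/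
def liouvillePotential (p Q : ℝ → ℝ) (y : ℝ) : ℝ := potential p y + Q (zetaInv p y)

variable {p : ℝ → ℝ} {u v : ℝ → ℂ}

theorem liouvilleQuasiDeriv_zeta (hp : Continuous p) (hpos : ∀ x, 0 < p x) (u v : ℝ → ℂ) (x : ℝ) :
    liouvilleQuasiDeriv p u v (zeta p x) =
      (liouvilleWeight p x)⁻¹ • (v x + (deriv p x / 4) • u x) := by
  rw [liouvilleQuasiDeriv, zetaInv_zeta hp hpos]

theorem surjective_liouvilleQuasiDeriv (hpos : ∀ x, 0 < p x) (hζ : Function.Surjective (zeta p))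
    (u : ℝ → ℂ) : Function.Surjective (liouvilleQuasiDeriv p u) := fun z => by
  refine ⟨fun x => liouvilleWeight p x • z (zeta p x) - (deriv p x / 4) • u x, funext fun y => ?_⟩
  rw [liouvilleQuasiDeriv, sub_add_cancel, inv_smul_smul₀ (liouvilleWeight_pos hpos _).ne',
    zeta_zetaInv hζ]

theorem locAC_liouvilleFun_iff (hp : ContDiff ℝ 1 p) (hpos : ∀ x, 0 < p x)
    (hζ : Function.Surjective (zeta p)) : LocAC (liouvilleFun p u) ↔ LocAC u := by
  rw [← locAC_comp_zeta_iff hp.continuous hpos hζ]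
  simp only [liouvilleFun_zeta hp.continuous hpos]
  exact LocAC.smul_iff (contDiff_liouvilleWeight hp hpos) fun x => (liouvilleWeight_pos hpos x).ne'

theorem locAC_liouvilleQuasiDeriv_iff (hp : ContDiff ℝ 1 p) (hp' : LocAC (deriv p))
    (hpos : ∀ x, 0 < p x) (hζ : Function.Surjective (zeta p)) (hu : LocAC u) :
    LocAC (liouvilleQuasiDeriv p u v) ↔ LocAC v := by
  have hr0 (x : ℝ) : liouvilleWeight p x ≠ 0 := (liouvilleWeight_pos hpos x).ne'
  have hp'4 : LocAC fun x => deriv p x / 4 := by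
    simpa only [div_eq_inv_mul, smul_eq_mul] using
      (LocAC.of_contDiff (contDiff_const (c := (4 : ℝ)⁻¹))).smul hp'
  rw [← locAC_comp_zeta_iff hp.continuous hpos hζ]
  simp only [liouvilleQuasiDeriv_zeta hp.continuous hpos]
  exact (LocAC.smul_iff ((contDiff_liouvilleWeight hp hpos).inv hr0)
    fun x => inv_ne_zero (hr0 x)).trans (LocAC.add_iff_left (hp'4.smul hu))

variable {u' v' : ℂ} {x : ℝ}

theorem hasDerivAt_liouvilleFun (hp : ContDiff ℝ 1 p) (hpos : ∀ x, 0 < p x)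
    (hζ : Function.Surjective (zeta p)) (hu : HasDerivAt u u' x) :
    HasDerivAt (liouvilleFun p u)
      ((liouvilleWeight p x)⁻¹ • (p x • u' + (deriv p x / 4) • u x)) (zeta p x) := by
  have hr0 := (liouvilleWeight_pos hpos x).ne'
  convert! hasDerivAt_of_comp_zeta hp.continuous hpos hζ (liouvilleFun_zeta hp.continuous hpos u)
    ((hasDerivAt_liouvilleWeight hp hpos x).fun_smul hu) using 1
  rw [← liouvilleWeight_pow_four hpos x]
  match_scalars <;> field

theorem potential_zeta (hp : Continuous p) (hpos : ∀ x, 0 < p x) (x : ℝ) :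
    potential p (zeta p x) = deriv (deriv p) x / 4 - deriv p x ^ 2 / (16 * p x) := by
  rw [potential, zetaInv_zeta hp hpos]

theorem liouvillePotential_zeta (hp : Continuous p) (hpos : ∀ x, 0 < p x) (Q : ℝ → ℝ) (x : ℝ) :
    liouvillePotential p Q (zeta p x) = potential p (zeta p x) + Q x := by
  rw [liouvillePotential, zetaInv_zeta hp hpos]

theorem liouvillePotential_zero : (liouvillePotential p fun _ => 0) = potential p :=
  funext fun _ => add_zero _

theorem hasDerivAt_liouvilleQuasiDeriv (hp : ContDiff ℝ 1 p) (hpos : ∀ x, 0 < p x)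
    (hζ : Function.Surjective (zeta p)) (hp' : DifferentiableAt ℝ (deriv p) x)
    (hu : HasDerivAt u u' x) (hv : HasDerivAt v v' x) (hvu : v x = p x • u') :
    HasDerivAt (liouvilleQuasiDeriv p u v)
      (liouvilleWeight p x • v' + potential p (zeta p x) • liouvilleWeight p x • u x)
      (zeta p x) := by
  have hr0 := (liouvilleWeight_pos hpos x).ne'
  convert! hasDerivAt_of_comp_zeta hp.continuous hpos hζ
    (liouvilleQuasiDeriv_zeta hp.continuous hpos u v)
    (((hasDerivAt_liouvilleWeight hp hpos x).fun_inv hr0).fun_smul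
      (hv.fun_add ((hp'.hasDerivAt.div_const 4).fun_smul hu))) using 1
  rw [potential_zeta hp.continuous hpos, hvu, ← liouvilleWeight_pow_four hpos x]
  -- The terms with `u'` cancel; this cancellation dictates the exponent `1/4` of the weight.
  match_scalars <;> field

theorem mem_slGraph_iff {p q : ℝ → ℝ} {f g : L2} :
    (f, g) ∈ slGraph p q ↔ ∃ u v : ℝ → ℂ, LocAC u ∧ LocAC v ∧ f =ᵐ[volume] u ∧
      (∀ᵐ x, v x = p x • deriv u x) ∧ ∀ᵐ x, g x = -deriv v x + q x • u x := by
  simp only [Complex.real_smul]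
  rfl

theorem liouville_ae_eq_liouvilleFun_iff (hp : Continuous p) (hpos : ∀ x, 0 < p x)
    (hζ : Function.Surjective (zeta p)) {f : L2} :
    liouville p f =ᵐ[volume] liouvilleFun p u ↔ f =ᵐ[volume] u := by
  refine (ae_comp_zeta_iff hp hpos hζ).symm.trans (eventually_congr ?_)
  filter_upwards [ae_liouville_zeta hp hpos hζ f] with x hf
  rw [hf, liouvilleFun_zeta hp hpos, smul_right_inj (liouvilleWeight_pos hpos x).ne']

theorem ae_liouvilleQuasiDeriv_eq_deriv_iff (hp : ContDiff ℝ 1 p) (hpos : ∀ x, 0 < p x)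
    (hζ : Function.Surjective (zeta p)) (hu : LocAC u) :
    (∀ᵐ y, liouvilleQuasiDeriv p u v y = deriv (liouvilleFun p u) y) ↔
      ∀ᵐ x, v x = p x • deriv u x := by
  refine (ae_comp_zeta_iff hp.continuous hpos hζ).symm.trans (eventually_congr ?_)
  filter_upwards [hu.ae_differentiableAt] with x hux
  rw [liouvilleQuasiDeriv_zeta hp.continuous hpos,
    (hasDerivAt_liouvilleFun hp hpos hζ hux.hasDerivAt).deriv,
    smul_right_inj (inv_ne_zero (liouvilleWeight_pos hpos x).ne'), add_left_inj]

theorem ae_liouville_eq_iff (hp : ContDiff ℝ 1 p) (hp' : LocAC (deriv p)) (hpos : ∀ x, 0 < p x)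
    (hζ : Function.Surjective (zeta p)) (hu : LocAC u) (hv : LocAC v)
    (hvu : ∀ᵐ x, v x = p x • deriv u x) (Q : ℝ → ℝ) {g : L2} :
    (∀ᵐ y, liouville p g y = -deriv (liouvilleQuasiDeriv p u v) y +
      liouvillePotential p Q y • liouvilleFun p u y) ↔
      ∀ᵐ x, g x = -deriv v x + Q x • u x := by
  refine (ae_comp_zeta_iff hp.continuous hpos hζ).symm.trans (eventually_congr ?_)
  filter_upwards [hu.ae_differentiableAt, hv.ae_differentiableAt,
    hp'.ae_differentiableAt_of_finiteDimensional, hvu, ae_liouville_zeta hp.continuous hpos hζ g]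
    with x hux hvx hpx hvux hg
  rw [hg, liouvilleFun_zeta hp.continuous hpos, liouvillePotential_zeta hp.continuous hpos,
    (hasDerivAt_liouvilleQuasiDeriv hp hpos hζ hpx hux.hasDerivAt hvx.hasDerivAt hvux).deriv,
    ← smul_right_inj (liouvilleWeight_pos hpos x).ne' (m₁ := g x)]
  congr! 1
  module

theorem liouville_mem_slGraph_iff (hp : ContDiff ℝ 1 p) (hp' : LocAC (deriv p))
    (hpos : ∀ x, 0 < p x) (hζ : Function.Surjective (zeta p)) (Q : ℝ → ℝ) {f g : L2} :
    (liouville p f, liouville p g) ∈ slGraph (fun _ => 1) (liouvillePotential p Q) ↔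
      (f, g) ∈ slGraph p Q := by
  -- Every pair of functions is `(liouvilleFun p u, liouvilleQuasiDeriv p u v)` for some `u`, `v`,
  -- so the two existential statements can be compared witness by witness.
  rw [mem_slGraph_iff, mem_slGraph_iff, (surjective_liouvilleFun hpos hζ).exists]
  simp only [one_smul]
  refine exists_congr fun u => ?_
  rw [(surjective_liouvilleQuasiDeriv hpos hζ u).exists]
  refine exists_congr fun v => ?_
  rw [locAC_liouvilleFun_iff hp hpos hζ, liouville_ae_eq_liouvilleFun_iff hp.continuous hpos hζ]
  refine and_congr_right fun hu => ?_
  rw [locAC_liouvilleQuasiDeriv_iff hp hp' hpos hζ hu,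
    ae_liouvilleQuasiDeriv_eq_deriv_iff hp hpos hζ hu]
  exact and_congr_right fun hv => and_congr_right fun _ => and_congr_right fun hvu =>
    ae_liouville_eq_iff hp hp' hpos hζ hu hv hvu Q

theorem intertwines_liouvilleEquiv (hp : ContDiff ℝ 1 p) (hp' : LocAC (deriv p))
    (hpos : ∀ x, 0 < p x) (hζ : Function.Surjective (zeta p)) (Q : ℝ → ℝ) :
    Intertwines (liouvilleEquiv hp.continuous hpos hζ) (slOperator p Q)
      (opB (liouvillePotential p Q)) := fun f g => by
  rw [opB, slOperator_graph, slOperator_graph, coe_liouvilleEquiv]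
  exact liouville_mem_slGraph_iff hp hp' hpos hζ Q

theorem image_liouville_PW (hp : LocAC p) (hp' : LocAC (deriv p)) (hpos : ∀ x, 0 < p x)
    (hζ : Function.Surjective (zeta p)) (Q : ℝ → ℝ) (Λ : Set ℝ) :
    liouville p '' PW Λ (slOperator p Q) = PW Λ (opB (liouvillePotential p Q)) :=
  (intertwines_liouvilleEquiv (hp.contDiff_one hp'.continuous) hp' hpos hζ Q).image_PW Λ

end Graph

/-! ### Reproducing kernels -/

section Kernel

theorem IsReproducingKernel.unique {V : Set L2} {k k' : ℝ → L2} (hk : IsReproducingKernel V k)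
    (hk' : IsReproducingKernel V k') : k = k' := by
  have hinner (f : L2) (hf : f ∈ V) (x : ℝ) : inner ℂ (k x - k' x) f = 0 := by
    obtain ⟨hc, he⟩ := hk.2 f hf
    obtain ⟨hc', he'⟩ := hk'.2 f hf
    rw [inner_sub_left, sub_eq_zero]
    exact congrFun (Measure.eq_of_ae_eq (he.symm.trans he') hc hc') x
  funext x
  rw [← sub_eq_zero, ← inner_self_eq_zero (𝕜 := ℂ), inner_sub_right, hinner _ (hk.1 x),
    hinner _ (hk'.1 x), sub_zero]

variable {p : ℝ → ℝ} {V : Set L2} {k h : ℝ → L2}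

theorem IsReproducingKernel.image_liouville (hk : IsReproducingKernel V k) (hp : Continuous p)
    (hpos : ∀ x, 0 < p x) (hζ : Function.Surjective (zeta p))
    (hV : ∀ z : ℂ, ∀ f ∈ V, z • f ∈ V) :
    IsReproducingKernel (liouville p '' V) fun y =>
      (liouvilleWeight p (zetaInv p y) : ℂ) • liouville p (k (zetaInv p y)) := by
  set U := liouvilleEquiv hp hpos hζ with hU
  rw [← coe_liouvilleEquiv hp hpos hζ, ← hU]
  refine ⟨fun y => ⟨_, hV _ _ (hk.1 _), U.map_smul _ _⟩, forall_mem_image.2 fun f hf => ?_⟩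
  obtain ⟨hcont, hae⟩ := hk.2 f hf
  simp only [inner_smul_left, Complex.conj_ofReal, U.inner_map_map]
  have hφ := continuous_zetaInv hp hpos hζ
  refine ⟨(Complex.continuous_ofReal.comp ((continuous_liouvilleWeight hp).comp hφ)).mul
    (hcont.comp hφ), (ae_comp_zeta_iff hp hpos hζ).1 ?_⟩
  filter_upwards [hae, ae_liouville_zeta hp hpos hζ f] with x hfx hUf
  rw [hU, coe_liouvilleEquiv, hUf, hfx, zetaInv_zeta hp hpos, Complex.real_smul]

theorem IsReproducingKernel.apply_zeta (hh : IsReproducingKernel (liouville p '' V) h)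
    (hk : IsReproducingKernel V k) (hp : Continuous p) (hpos : ∀ x, 0 < p x)
    (hζ : Function.Surjective (zeta p)) (hV : ∀ z : ℂ, ∀ f ∈ V, z • f ∈ V) (x : ℝ) :
    h (zeta p x) = (liouvilleWeight p x : ℂ) • liouville p (k x) := by
  simpa only [zetaInv_zeta hp hpos] using
    congrFun (hh.unique (hk.image_liouville hp hpos hζ hV)) (zeta p x)

variable {c C : ℝ} {ι : Type*} {x : ι → ℝ}

theorem IsReproducingKernel.isFrame_zeta_iff (hh : IsReproducingKernel (liouville p '' V) h)
    (hk : IsReproducingKernel V k) (hp : Continuous p) (hc : 0 < c) (hpc : ∀ x, p x ∈ Icc c C)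
    (hV : ∀ z : ℂ, ∀ f ∈ V, z • f ∈ V) :
    IsFrame (liouville p '' V) (fun i => h (zeta p (x i))) ↔ IsFrame V fun i => k (x i) := by
  have hpos (x : ℝ) : 0 < p x := hc.trans_le (hpc x).1
  have hC : 0 < C := (hpos 0).trans_le (hpc 0).2
  have hζ := surjective_zeta_of_forall_le hp hpos fun x => (hpc x).2
  simp only [hh.apply_zeta hk hp hpos hζ hV, ← coe_liouvilleEquiv hp hpos hζ, ← map_smul]
  rw [isFrame_image_iff]
  exact isFrame_smul_iff hV (Real.rpow_pos_of_pos hc _) (Real.rpow_pos_of_pos hC _)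
    fun i => norm_liouvilleWeight_mem_Icc hc (hpc (x i))

theorem IsReproducingKernel.isRieszSequence_zeta_iff
    (hh : IsReproducingKernel (liouville p '' V) h) (hk : IsReproducingKernel V k)
    (hp : Continuous p) (hc : 0 < c) (hpc : ∀ x, p x ∈ Icc c C)
    (hV : ∀ z : ℂ, ∀ f ∈ V, z • f ∈ V) :
    IsRieszSequence (liouville p '' V) (fun i => h (zeta p (x i))) ↔
      IsRieszSequence V fun i => k (x i) := by
  have hpos (x : ℝ) : 0 < p x := hc.trans_le (hpc x).1
  have hC : 0 < C := (hpos 0).trans_le (hpc 0).2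
  have hζ := surjective_zeta_of_forall_le hp hpos fun x => (hpc x).2
  simp only [hh.apply_zeta hk hp hpos hζ hV, ← coe_liouvilleEquiv hp hpos hζ, ← map_smul]
  rw [isRieszSequence_image_iff]
  exact isRieszSequence_smul_iff hV (Real.rpow_pos_of_pos hc _) (Real.rpow_pos_of_pos hC _)
    fun i => norm_liouvilleWeight_mem_Icc hc (hpc (x i))

end Kernel

end VariableBandwidth

end

theorem mainTheorem7_general (p Q : ℝ → ℝ) (hp : LocAC p) (hp' : LocAC (deriv p))
    (hpos : ∀ x, 0 < p x) (Λ : Set ℝ) :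
    (Function.Surjective (zeta p) →
      liouville p '' PW Λ (slOperator p Q) = PW Λ (opB (liouvillePotential p Q)) ∧
      (∀ X : Set ℝ,
        upperDensity (muP p) X = upperDensity volume (zeta p '' X) ∧
        lowerDensity (muP p) X = lowerDensity volume (zeta p '' X)) ∧
      (∀ k h : ℝ → L2,
        IsReproducingKernel (PW Λ (slOperator p Q)) k →
        IsReproducingKernel (PW Λ (opB (liouvillePotential p Q))) h →
        ∀ x : ℝ, h (zeta p x) = ((p x ^ (1 / 4 : ℝ) : ℝ) : ℂ) • liouville p (k x))) ∧
    (∀ c C : ℝ, 0 < c → (∀ x, c ≤ p x ∧ p x ≤ C) →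
      ∀ k h : ℝ → L2,
        IsReproducingKernel (PW Λ (slOperator p Q)) k →
        IsReproducingKernel (PW Λ (opB (liouvillePotential p Q))) h →
        ∀ X : Set ℝ,
          (IsFrame (PW Λ (slOperator p Q)) (fun x : X => k x) ↔
            IsFrame (PW Λ (opB (liouvillePotential p Q))) (fun x : X => h (zeta p x))) ∧
          (IsRieszSequence (PW Λ (slOperator p Q)) (fun x : X => k x) ↔
            IsRieszSequence (PW Λ (opB (liouvillePotential p Q)))
              (fun x : X => h (zeta p x)))) := by
  have hpc : Continuous p := hp.continuous
  have hV (c : ℂ) (f : L2) (hf : f ∈ PW Λ (slOperator p Q)) : c • f ∈ PW Λ (slOperator p Q) :=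
    smul_mem_PW c hf
  refine ⟨fun hζ => ?_, fun c C hc hpcC k h hk hh X => ?_⟩
  · have hPW := image_liouville_PW hp hp' hpos hζ Q Λ
    refine ⟨hPW, fun X => ⟨(upperDensity_image_zeta hpc hpos hζ X).symm,
      (lowerDensity_image_zeta hpc hpos hζ X).symm⟩, fun k h hk hh => ?_⟩
    exact (hPW ▸ hh).apply_zeta hk hpc hpos hζ hV
  · have hζ := surjective_zeta_of_forall_le hpc hpos fun x => (hpcC x).2
    rw [← image_liouville_PW hp hp' hpos hζ Q Λ] at hh ⊢
    exact ⟨(hh.isFrame_zeta_iff hk hpc hc hpcC hV).symm,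
      (hh.isRieszSequence_zeta_iff hk hpc hc hpcC hV).symm⟩

theorem mainTheorem7 (p : ℝ → ℝ) (hp : LocAC p) (hp' : LocAC (deriv p)) (hpos : ∀ x, 0 < p x)
    (Λ : Set ℝ) (hΛ : MeasurableSet Λ) :
    (Function.Surjective (zeta p) →
      liouville p '' PW Λ (opA p) = PW Λ (opB (potential p)) ∧
      (∀ X : Set ℝ,
        upperDensity (muP p) X = upperDensity volume (zeta p '' X) ∧
        lowerDensity (muP p) X = lowerDensity volume (zeta p '' X)) ∧
      (∀ k h : ℝ → L2,
        IsReproducingKernel (PW Λ (opA p)) k →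
        IsReproducingKernel (PW Λ (opB (potential p))) h →
        ∀ x : ℝ, h (zeta p x) = ((p x ^ (1 / 4 : ℝ) : ℝ) : ℂ) • liouville p (k x))) ∧
    (∀ c C : ℝ, 0 < c → (∀ x, c ≤ p x ∧ p x ≤ C) →
      ∀ k h : ℝ → L2,
        IsReproducingKernel (PW Λ (opA p)) k →
        IsReproducingKernel (PW Λ (opB (potential p))) h →
        ∀ X : Set ℝ,
          (IsFrame (PW Λ (opA p)) (fun x : X => k x) ↔
            IsFrame (PW Λ (opB (potential p))) (fun x : X => h (zeta p x))) ∧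
          (IsRieszSequence (PW Λ (opA p)) (fun x : X => k x) ↔
            IsRieszSequence (PW Λ (opB (potential p))) (fun x : X => h (zeta p x)))) := by
  simpa only [opA, liouvillePotential_zero] using mainTheorem7_general p (fun _ => 0) hp hp' hpos Λ
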